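/- **Setting.** Nodes $a_1,a_2,\dots$ test $H_0$ against $H_1$, with prior probabilities $\pi_0,\pi_1>0$, $\pi_0+\pi_1=1$; $\mathbb P_j$ denotes probability under $H_j$. Node $a_k$ has a private signal $X_k$; under $H_j$ the signals are i.i.d. with law $\mathbb P_j^X$, where $\mathbb P_0^X$ and $\mathbb P_1^X$ are mutually absolutely continuous, $L_X=d\mathbb P_1^X/d\mathbb P_0^X$. Assume that the private belief $\bar b=\pi_1L_X/(\pi_0+\pi_1L_X)$ has linear tails: $\mathbb P_0^X(\bar b\le r)=\Theta(r)$ and $\mathbb P_1^X(\bar b\ge 1-r)=\Theta(r)$ as $r\downarrow 0$. The decision broadcast by $a_k$ passes through a memoryless binary erasure channel: it is erased (for all successors) with probability $q_k$, independently of the decision, of the other erasures and of the signals, under either hypothesis. The erasure probabilities are bounded away from $1$: $q_k\le 1-\epsilon$ for all $k$, for some $\epsilon>0$. Node $a_k$ observes the broadcasts of its $m_k<k$ immediate predecessors. **Scheme (backward search with the equilibrium strategy).** Let $n_k$ be the largest integer $n$ with $k-n^2\ge 1$ such that each of $a_{k-n^2},\dots,a_k$ has memory size at least $n$. Put $k_0=k$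 and let $a_{k_{i+1}}$ be the most recent node among the $n_k$ immediate predecessors of $a_{k_i}$ whose broadcast is not erased; $\mathcal E_k$ is the event that $k_1,\dots,k_{n_k}$ all exist, so that $a_{k_{n_k}},\dots,a_{k_1},a_k$ form a tandem network of length $n_k$. On $\mathcal E_k$ the nodes of this tandem network use the equilibrium strategy of a tandem network, i.e. each node applies the maximum a posteriori test to what it has: the first node decides $1$ iff $L_X>\pi_0/\pi_1$ at its signal; a node with $i+1$ tandem predecessors that receives the decision $b$ of its immediate tandem predecessor decides $1$ iff $L_X\cdot p_1^{i}(b)/p_0^{i}(b)>\pi_0/\pi_1$, where $p_j^{i}$ is the law under $H_j$ of the decision of a tandem node with $i$ predecessors. The decision $d_k$ is the resulting decision of $a_k$ on $\mathcal E_k$, and arbitrary off $\mathcal E_k$. **Corollary 3.** Suppose that $m_k=\Theta(k^\sigma)$ where $\sigma\le 1$. Then the error probability $\mathbb P(d_k\ne\theta)=\pi_0\mathbb P_0(d_k=1)+\pi_1\mathbb P_1(d_k=0)$ satisfies, as $k\to\infty$, $$\mathbb P(d_k\neq\theta)=\begin{cases}\Theta(1/\sqrt k)&\text{if }\sigma\ge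 1/2,\\ \Theta(1/k^{\sigma})&\text{if }\sigma<1/2.\end{cases}$$ -/

import Mathlib

open MeasureTheory ProbabilityTheory Filter Asymptotics Topology
open scoped ENNReal

/-! Hypotheses and decisions are Booleans: `false` stands for `H₀` / decision `0`, `true` for
`H₁` / decision `1`.  Nodes are `a₁, a₂, …`; index `0` is never used. -/

namespace ErasureNetwork

noncomputable section

variable {S : Type*} [MeasurableSpace S]

/-- The likelihood ratio `L_X = dP₁ˣ / dP₀ˣ` of a private signal. -/
def signalLR (PX : Bool → Measure S) (s : S) : ℝ≥0∞ :=
  (PX true).rnDeriv (PX false) s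

/-- The private belief `P(θ = H₁ | X = s) = π₁ L_X(s) / (π₀ + π₁ L_X(s))`, which is
`(1 + (π₀ / π₁) / L_X(s))⁻¹` where `L_X(s) ≠ 0`. -/
def privateBelief (prior : Bool → ℝ) (PX : Bool → Measure S) (s : S) : ℝ :=
  prior true * (signalLR PX s).toReal / (prior false + prior true * (signalLR PX s).toReal)

/-- The private belief puts mass of exact order `r` within distance `r` of either certainty:
`P₀(belief ≤ r) = Θ(r)` and `P₁(belief ≥ 1 - r) = Θ(r)` as `r → 0+`. -/
structure HasLinearTails (prior : Bool → ℝ) (PX : Bool → Measure S) : Prop where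
  lower : (fun r : ℝ => (PX false).real {s | privateBelief prior PX s ≤ r}) =Θ[𝓝[>] 0]
    fun r : ℝ => r
  upper : (fun r : ℝ => (PX true).real {s | 1 - r ≤ privateBelief prior PX s}) =Θ[𝓝[>] 0]
    fun r : ℝ => r

/-- The threshold `π₀ / π₁` of the MAP test. -/
def mapThreshold (prior : Bool → ℝ) : ℝ≥0∞ :=
  ENNReal.ofReal (prior false / prior true)

/-- The MAP test of a node that has only its private signal. -/
def privateTest (prior : Bool → ℝ) (PX : Bool → Measure S) (s : S) : Bool :=
  open Classical in decide (mapThreshold prior < signalLR PX s)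

/-- The MAP test of a node that has its private signal `s` and one received decision `b`, where
`Q j` is the law of the received decision under `H_j`: decide `1` iff
`L_X(s) · Q₁(b) / Q₀(b) > π₀ / π₁`. -/
def relayTest (prior : Bool → ℝ) (PX : Bool → Measure S) (Q : Bool → Measure Bool)
    (s : S) (b : Bool) : Bool :=
  open Classical in decide (mapThreshold prior < signalLR PX s * (Q true {b} / Q false {b}))

/-- `tandemLaw prior PX i j` is the law under `H_j` of the decision of the node that has `i`
predecessors in a tandem network, when every node of the tandem applies the MAP test to its own
private signal and the decision of its immediate predecessor (the equilibrium strategy). -/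
def tandemLaw (prior : Bool → ℝ) (PX : Bool → Measure S) : ℕ → Bool → Measure Bool
  | 0 => fun j => (PX j).map (privateTest prior PX)
  | i + 1 => fun j => ((PX j).prod (tandemLaw prior PX i j)).map
      (fun p => relayTest prior PX (tandemLaw prior PX i) p.1 p.2)

/-- `n_k`: the largest `n` such that each of the nodes `a_{k - n²}, …, a_k` (there have to be that
many, i.e. `k - n² ≥ 1`) has memory size at least `n`. -/
def tandemLength (m : ℕ → ℕ) (k : ℕ) : ℕ :=
  Nat.findGreatest (fun n => n ^ 2 < k ∧ ∀ i, k - n ^ 2 ≤ i → i ≤ k → n ≤ m i) k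

theorem tandemLength_isGreatest (m : ℕ → ℕ) (k : ℕ) (hk : 1 ≤ k) :
    IsGreatest {n | n ^ 2 < k ∧ ∀ i, k - n ^ 2 ≤ i → i ≤ k → n ≤ m i} (tandemLength m k) := by
  constructor
  · exact Nat.findGreatest_spec
      (P := fun n => n ^ 2 < k ∧ ∀ i, k - n ^ 2 ≤ i → i ≤ k → n ≤ m i) (Nat.zero_le k)
      ⟨by simp; omega, fun _ _ _ => Nat.zero_le _⟩
  · intro n hn
    refine Nat.le_findGreatest ?_ hn
    have := hn.1
    nlinarith

/-- The nodes among the `n` immediate predecessors of `a_k` whose broadcast is not erased;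
`er i = true` means that the broadcast of `a_i` is erased. -/
def unerased (er : ℕ → Bool) (n k : ℕ) : Finset ℕ :=
  (Finset.Ico (k - n) k).filter (fun i => er i = false)

/-- The most recent node, among the `n` immediate predecessors of `a_k`, from which `a_k` receives
an unerased decision. -/
def latestUnerased (er : ℕ → Bool) (n k : ℕ) : Option ℕ :=
  if h : (unerased er n k).Nonempty then some ((unerased er n k).max' h) else none

/-- Backward search from `a_k`: the nodes `k = k₀ > k₁ > k₂ > …`, where `k_{i+1}` is the most
recent of the `n` immediate predecessors of `a_{k_i}` whose decision reaches `a_{k_i}`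
(`none` once the search has failed). -/
def backwardSearch (er : ℕ → Bool) (n k : ℕ) : ℕ → Option ℕ
  | 0 => some k
  | i + 1 => (backwardSearch er n k i).bind (latestUnerased er n)

/-- A tandem network of length `n` ending at `a_k` is found by the backward search. -/
def HasTandem (er : ℕ → Bool) (n k : ℕ) : Prop :=
  (backwardSearch er n k n).isSome

/-- The decision of node `a_k` when it is used as a tandem node with `i` tandem predecessors, found
by backward search among `n` immediate predecessors at each step: `a_k` applies the MAP test to its
private signal `x k` and the one decision it takes from the network.  (If the search fails, the node
where it fails relies on its private signal alone.) -/
def tandemDecision (prior : Bool → ℝ) (PX : Bool → Measure S) (x : ℕ → S) (er : ℕ → Bool)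
    (n : ℕ) : ℕ → ℕ → Bool
  | 0, k => privateTest prior PX (x k)
  | i + 1, k =>
    match latestUnerased er n k with
    | some k' => relayTest prior PX (tandemLaw prior PX i) (x k)
        (tandemDecision prior PX x er n i k')
    | none => privateTest prior PX (x k)

/-- The error probability `π₀ P₀(d = 1) + π₁ P₁(d = 0)` of a decision `d`. -/
def errorProb {Ω : Type*} [MeasurableSpace Ω] (prior : Bool → ℝ) (P : Bool → Measure Ω)
    (d : Ω → Bool) : ℝ :=
  prior false * (P false).real {ω | d ω = true} + prior true * (P true).real {ω | d ω = false}

/-- The random elements of the network under the two hypotheses: `X k` is the private signal of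
`a_k`, and `Z k = true` means that its broadcast is erased.  Under `H_j` the signals are i.i.d. with
law `PX j`; broadcasts go through a memoryless binary erasure channel, so that the erasures are
independent, independent of the signals, and `a_k`'s broadcast is erased with probability `q k`,
whatever its decision is. -/
structure IsModel {Ω : Type*} [MeasurableSpace Ω] (P : Bool → Measure Ω) (PX : Bool → Measure S)
    (q : ℕ → ℝ) (X : ℕ → Ω → S) (Z : ℕ → Ω → Bool) : Prop where
  measurable_signal : ∀ k, Measurable (X k)
  measurable_erasure : ∀ k, Measurable (Z k)
  signal_law : ∀ j k, 1 ≤ k → (P j).map (X k) = PX j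
  erasure_prob : ∀ j k, 1 ≤ k → (P j).real {ω | Z k ω = true} = q k
  indep_signal : ∀ j, iIndepFun X (P j)
  indep_erasure : ∀ j, iIndepFun Z (P j)
  indep_signal_erasure : ∀ j, IndepFun (fun ω k => X k ω) (fun ω k => Z k ω) (P j)

end

end ErasureNetwork

/-! Linear tails make the progress of a tandem network exactly quadratic: if `e` is the error
probability of a node, its successor overturns a wrong decision only with the help of a signal
whose likelihood ratio is of order `e` or `1 / e`, an event of probability of order `e` under the
true hypothesis.  Errors, of joint probability of order `e`, are therefore corrected to a net gain
`e_i - e_{i+1}` of exact order `e_i ^ 2`.  Hence the increments of `1 / e_i` are bounded away from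
`0` and `∞`, and `e_i` is of exact order `1 / i`.

The erasures are independent of the signals.  Conditionally on them, the backward search from `a_k`
either fails or produces a tandem network of length `n_k` whose last decision has the law of the
ideal tandem network.  A failure requires `n_k` consecutive erasures at one of at most `n_k ^ 2 + 1`
places, which has probability `O(n_k ^ 2 (1 - ε) ^ n_k) = O(1 / n_k)`.  So the error probability is
of exact order `1 / n_k`, and `n_k` is of exact order `k ^ min σ (1 / 2)`, because `n_k ^ 2 < k` and
`n_k ≤ m_k` are, up to a constant factor, the only constraints on `n_k`. -/

namespace ErasureNetwork

section Asymptotics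

theorem isTheta_iff_exists_bounds {α : Type*} {l : Filter α} {f g : α → ℝ}
    (hf : ∀ᶠ x in l, 0 ≤ f x) (hg : ∀ᶠ x in l, 0 ≤ g x) :
    f =Θ[l] g ↔ ∃ c C, 0 < c ∧ 0 < C ∧ ∀ᶠ x in l, c * g x ≤ f x ∧ f x ≤ C * g x := by
  constructor
  · rintro ⟨hfg, hgf⟩
    obtain ⟨C, hC, hfg⟩ := hfg.exists_pos
    obtain ⟨K, hK, hgf⟩ := hgf.exists_pos
    refine ⟨K⁻¹, C, inv_pos.2 hK, hC, ?_⟩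
    filter_upwards [hf, hg, hfg.bound, hgf.bound] with x hfx hgx hle hge
    rw [Real.norm_of_nonneg hfx, Real.norm_of_nonneg hgx] at hle hge
    exact ⟨(inv_mul_le_iff₀ hK).2 hge, hle⟩
  · rintro ⟨c, C, hc, -, h⟩
    constructor
    · refine IsBigO.of_bound C ?_
      filter_upwards [hf, hg, h] with x hfx hgx hx
      rw [Real.norm_of_nonneg hfx, Real.norm_of_nonneg hgx]
      exact hx.2
    · refine IsBigO.of_bound c⁻¹ ?_
      filter_upwards [hf, hg, h] with x hfx hgx hx
      rw [Real.norm_of_nonneg hfx, Real.norm_of_nonneg hgx]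
      exact (le_inv_mul_iff₀ hc).2 hx.1

theorem isTheta_min_one_of_monotoneOn {F : ℝ → ℝ} (hmono : MonotoneOn F (Set.Ioi 0))
    (hF0 : ∀ t, 0 ≤ F t) (hF1 : ∀ t, F t ≤ 1) (hF : F =Θ[𝓝[>] 0] fun t => t) :
    F =Θ[𝓟 (Set.Ioi 0)] fun t => min t 1 := by
  obtain ⟨c, C, hc, hC, hcC⟩ := (isTheta_iff_exists_bounds (.of_forall hF0)
    (eventually_mem_nhdsWithin.mono fun t ht => (Set.mem_Ioi.1 ht).le)).1 hF
  obtain ⟨δ, hδ, hbound⟩ := mem_nhdsGT_iff_exists_Ioc_subset.1 hcC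
  obtain ⟨η, hη, hη1, hηδ⟩ : ∃ η, 0 < η ∧ η ≤ 1 ∧ η ≤ δ :=
    ⟨min δ 1, lt_min hδ one_pos, min_le_right _ _, min_le_left _ _⟩
  refine (isTheta_iff_exists_bounds (.of_forall hF0)
    (eventually_principal.2 fun t ht => le_min (Set.mem_Ioi.1 ht).le one_pos.le)).2
    ⟨c * η, C + η⁻¹, by positivity, by positivity, eventually_principal.2 fun t (ht : 0 < t) => ?_⟩
  constructor
  · have hscale : η * min t 1 ≤ min t η := le_min
      ((mul_le_of_le_one_left (by positivity) hη1).trans (min_le_left _ _))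
      (mul_le_of_le_one_right hη.le (min_le_right _ _))
    calc c * η * min t 1 = c * (η * min t 1) := mul_assoc _ _ _
      _ ≤ c * min t η := by gcongr
      _ ≤ F (min t η) := (hbound ⟨lt_min ht hη, (min_le_right _ _).trans hηδ⟩).1
      _ ≤ F t := hmono (Set.mem_Ioi.2 (lt_min ht hη)) ht (min_le_left _ _)
  · rcases le_total t η with htη | hηt
    · calc F t ≤ C * t := (hbound ⟨ht, htη.trans hηδ⟩).2
        _ ≤ (C + η⁻¹) * min t 1 := by
          rw [min_eq_left (htη.trans hη1)]
          gcongr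
          exact le_add_of_nonneg_right (by positivity)
    · calc F t ≤ 1 := hF1 t
        _ = η⁻¹ * η := (inv_mul_cancel₀ hη.ne').symm
        _ ≤ (C + η⁻¹) * min t 1 := by
          gcongr
          · exact le_add_of_nonneg_left hC.le
          · exact le_min hηt hη1

theorem pos_of_isTheta_min_one {F : ℝ → ℝ} (hF0 : ∀ t, 0 ≤ F t)
    (hF : F =Θ[𝓟 (Set.Ioi 0)] fun t => min t 1) {t : ℝ} (ht : 0 < t) : 0 < F t :=
  (hF0 t).lt_of_ne' fun h =>
    (lt_min ht one_pos).ne' ((eventually_principal.1 hF.eq_zero_iff t ht).1 h)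

theorem isTheta_add_one_of_increments_mem_Icc {u : ℕ → ℝ} {c C : ℝ} (hu : 0 < u 0) (hc : 0 < c)
    (h : ∀ n, u (n + 1) - u n ∈ Set.Icc c C) : u =Θ[⊤] fun n : ℕ => (n : ℝ) + 1 := by
  have hlower : ∀ n : ℕ, min (u 0) c * (n + 1) ≤ u n := fun n => by
    induction n with
    | zero => simp
    | succ n ih => push_cast; linarith [(h n).1, min_le_right (u 0) c]
  have hupper : ∀ n : ℕ, u n ≤ max (u 0) C * (n + 1) := fun n => by
    induction n with
    | zero => simp
    | succ n ih => push_cast; linarith [(h n).2, le_max_right (u 0) C]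
  have hmin : 0 < min (u 0) c := lt_min hu hc
  exact (isTheta_iff_exists_bounds
    (.of_forall fun n => (mul_nonneg hmin.le (by positivity)).trans (hlower n))
    (.of_forall fun n => by positivity)).2
    ⟨_, _, hmin, lt_max_of_lt_left hu, .of_forall fun n => ⟨hlower n, hupper n⟩⟩

theorem tendsto_zero_of_quadratic_decrement {e : ℕ → ℝ} (hpos : ∀ n, 0 < e n) {c : ℝ} (hc : 0 < c)
    (h : ∀ n, c * e n ^ 2 ≤ e n - e (n + 1)) : Tendsto e atTop (𝓝 0) := by
  have hanti : Antitone e := antitone_nat_of_succ_le fun n => by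
    have := mul_nonneg hc.le (sq_nonneg (e n))
    linarith [h n]
  have hlim : Tendsto e atTop (𝓝 (⨅ n, e n)) :=
    tendsto_atTop_ciInf hanti ⟨0, Set.forall_mem_range.2 fun n => (hpos n).le⟩
  have hzero : c * (⨅ n, e n) ^ 2 ≤ 0 := by
    refine (le_of_tendsto_of_tendsto' ((hlim.pow 2).const_mul c)
      (hlim.sub (hlim.comp (tendsto_add_atTop_nat 1))) h).trans_eq (sub_self _)
  rwa [pow_eq_zero_iff two_ne_zero |>.1 <| le_antisymm (nonpos_of_mul_nonpos_right hzero hc)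
    (sq_nonneg _)] at hlim

theorem isBigO_succ_of_quadratic_decrement {e : ℕ → ℝ} (hpos : ∀ n, 0 < e n)
    (hlim : Tendsto e atTop (𝓝 0)) {C : ℝ} (h : ∀ n, e n - e (n + 1) ≤ C * e n ^ 2) :
    e =O[⊤] fun n => e (n + 1) := by
  refine IsBigO.nat_of_atTop ?_ (Eventually.of_forall fun n hn => absurd hn (hpos _).ne')
  have hsmall : ∀ᶠ n in atTop, C * e n < 1 / 2 :=
    (hlim.const_mul C).eventually_lt_const (by norm_num)
  refine IsBigO.of_bound 2 (hsmall.mono fun n hn => ?_)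
  rw [Real.norm_of_nonneg (hpos n).le, Real.norm_of_nonneg (hpos (n + 1)).le]
  nlinarith [h n, hpos n]

theorem isTheta_inv_add_one_of_quadratic_decrement {e : ℕ → ℝ} (hpos : ∀ n, 0 < e n) {c C : ℝ}
    (hc : 0 < c) (h : ∀ n, e n - e (n + 1) ∈ Set.Icc (c * e n ^ 2) (C * e n ^ 2)) :
    e =Θ[⊤] fun n : ℕ => ((n : ℝ) + 1)⁻¹ := by
  obtain ⟨K, -, hK⟩ := (isBigO_succ_of_quadratic_decrement hpos
    (tendsto_zero_of_quadratic_decrement hpos hc fun n => (h n).1) fun n => (h n).2).exists_pos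
  have hratio : ∀ n, e n ≤ K * e (n + 1) := fun n => by
    have := eventually_top.1 hK.bound n
    rwa [Real.norm_of_nonneg (hpos n).le, Real.norm_of_nonneg (hpos (n + 1)).le] at this
  have hC : 0 ≤ C := by
    have := (h 0).1.trans (h 0).2
    exact hc.le.trans (le_of_mul_le_mul_right this (pow_pos (hpos 0) 2))
  have hincr : ∀ n, (e (n + 1))⁻¹ - (e n)⁻¹ ∈ Set.Icc c (C * K) := fun n => by
    have h₀ := hpos n
    have h₁ := hpos (n + 1)
    rw [inv_sub_inv h₁.ne' h₀.ne']
    constructor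
    · rw [le_div_iff₀ (by positivity)]
      have hle : e (n + 1) ≤ e n := by nlinarith [(h n).1]
      calc c * (e (n + 1) * e n) ≤ c * (e n * e n) := by gcongr
        _ ≤ e n - e (n + 1) := (sq (e n)) ▸ (h n).1
    · rw [div_le_iff₀ (by positivity)]
      calc e n - e (n + 1) ≤ C * (e n * e n) := (sq (e n)) ▸ (h n).2
        _ ≤ C * (K * e (n + 1) * e n) := by gcongr; exact hratio n
        _ = C * K * (e (n + 1) * e n) := by ring
  simpa only [inv_inv] using
    (isTheta_add_one_of_increments_mem_Icc (u := fun n => (e n)⁻¹)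
      (inv_pos.2 (hpos 0)) hc hincr).inv

end Asymptotics

section Posterior

variable {p₀ p₁ : ℝ}

/-- The posterior probability of a hypothesis of prior probability `p₁`, against an alternative of
prior probability `p₀`, after an observation of likelihood ratio `t`. -/
noncomputable def posterior (p₀ p₁ t : ℝ) : ℝ :=
  p₁ * t / (p₀ + p₁ * t)

theorem posterior_le_posterior_iff (hp₀ : 0 < p₀) (hp₁ : 0 < p₁) {s t : ℝ} (hs : 0 ≤ s)
    (ht : 0 ≤ t) : posterior p₀ p₁ s ≤ posterior p₀ p₁ t ↔ s ≤ t := by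
  rw [posterior, posterior, div_le_div_iff₀ (by positivity) (by positivity)]
  refine Iff.trans ?_ (mul_le_mul_iff_right₀ (mul_pos hp₁ hp₀))
  constructor <;> intro h <;> linarith

theorem one_sub_posterior (hp₀ : 0 < p₀) (hp₁ : 0 < p₁) {t : ℝ} (ht : 0 < t) :
    1 - posterior p₀ p₁ t = posterior p₁ p₀ t⁻¹ := by
  rw [posterior, posterior]
  field_simp
  ring

theorem tendsto_posterior (hp₀ : 0 < p₀) (hp₁ : 0 < p₁) :
    Tendsto (posterior p₀ p₁) (𝓝[>] 0) (𝓝[>] 0) := by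
  refine tendsto_nhdsWithin_iff.2 ⟨?_, eventually_mem_nhdsWithin.mono fun t (ht : 0 < t) => ?_⟩
  · have hcont : ContinuousAt (posterior p₀ p₁) 0 :=
      ContinuousAt.div (by fun_prop) (by fun_prop) (by simpa using hp₀.ne')
    simpa [posterior] using hcont.tendsto.mono_left nhdsWithin_le_nhds
  · exact Set.mem_Ioi.2 (by unfold posterior; positivity)

theorem posterior_isTheta (hp₀ : 0 < p₀) (hp₁ : 0 < p₁) :
    posterior p₀ p₁ =Θ[𝓝[>] 0] fun t => t := by
  have hlim : Tendsto (fun t => (p₀ + p₁ * t) / p₁) (𝓝[>] 0) (𝓝 (p₀ / p₁)) :=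
    (Continuous.tendsto' (by fun_prop) 0 _ (by simp)).mono_left nhdsWithin_le_nhds
  refine isTheta_of_div_tendsto_nhds_ne_zero (hlim.congr' ?_) (div_pos hp₀ hp₁).ne'
  filter_upwards [self_mem_nhdsWithin] with t (ht : 0 < t)
  rw [posterior]
  field_simp

theorem comp_posterior_isTheta (hp₀ : 0 < p₀) (hp₁ : 0 < p₁) {F : ℝ → ℝ}
    (hF : F =Θ[𝓝[>] 0] fun t => t) : (F ∘ posterior p₀ p₁) =Θ[𝓝[>] 0] fun t => t :=
  IsTheta.trans ⟨hF.1.comp_tendsto (tendsto_posterior hp₀ hp₁),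
    hF.2.comp_tendsto (tendsto_posterior hp₀ hp₁)⟩ (posterior_isTheta hp₀ hp₁)

end Posterior

variable {S : Type*} [MeasurableSpace S]

section LikelihoodRatio

variable (PX : Bool → Measure S)

theorem measurable_signalLR : Measurable (signalLR PX) :=
  Measure.measurable_rnDeriv _ _

variable [∀ j, IsFiniteMeasure (PX j)]

theorem ae_signalLR_lt_top : ∀ᵐ s ∂(PX false), signalLR PX s < ∞ :=
  Measure.rnDeriv_lt_top _ _

theorem real_true_le_mul (hPX₁₀ : PX true ≪ PX false) {A : Set S} {t : ℝ} (ht : 0 ≤ t)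
    (hA : ∀ s ∈ A, signalLR PX s ≤ ENNReal.ofReal t) :
    (PX true).real A ≤ t * (PX false).real A := by
  have h : PX true A ≤ ENNReal.ofReal t * PX false A := by
    rw [← Measure.setLIntegral_rnDeriv hPX₁₀ A, ← setLIntegral_const]
    exact setLIntegral_mono measurable_const hA
  simpa [Measure.real, ht] using ENNReal.toReal_mono (by finiteness) h

theorem mul_le_real_true (hPX₁₀ : PX true ≪ PX false) {A : Set S} {t : ℝ} (ht : 0 ≤ t)
    (hA : ∀ s ∈ A, ENNReal.ofReal t ≤ signalLR PX s) :
    t * (PX false).real A ≤ (PX true).real A := by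
  have h : ENNReal.ofReal t * PX false A ≤ PX true A := by
    rw [← Measure.setLIntegral_rnDeriv hPX₁₀ A, ← setLIntegral_const]
    exact setLIntegral_mono (measurable_signalLR PX) hA
  simpa [Measure.real, ht] using ENNReal.toReal_mono (by finiteness) h

end LikelihoodRatio

section Tails

/-- The probability under `H₀` that the likelihood ratio is at most `t`. -/
noncomputable def lrLowerTail (PX : Bool → Measure S) (t : ℝ) : ℝ :=
  (PX false).real {s | signalLR PX s ≤ ENNReal.ofReal t}

/-- The probability under `H₁` that the likelihood ratio is at least `t⁻¹`; the threshold is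
inverted in order that both tails vanish as `t → 0+`. -/
noncomputable def lrUpperTail (PX : Bool → Measure S) (t : ℝ) : ℝ :=
  (PX true).real {s | ENNReal.ofReal t⁻¹ ≤ signalLR PX s}

variable {prior : Bool → ℝ} {PX : Bool → Measure S}

theorem privateBelief_eq_posterior (s : S) : privateBelief prior PX s =
    posterior (prior false) (prior true) (signalLR PX s).toReal :=
  rfl

variable [∀ j, IsProbabilityMeasure (PX j)]

theorem lrLowerTail_eq (hprior : ∀ j, 0 < prior j) {t : ℝ} (ht : 0 < t) :
    lrLowerTail PX t =
      (PX false).real {s | privateBelief prior PX s ≤ posterior (prior false) (prior true) t} := by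
  refine measureReal_congr ?_
  filter_upwards [ae_signalLR_lt_top PX] with s hs
  refine propext ?_
  change signalLR PX s ≤ _ ↔ privateBelief prior PX s ≤ _
  rw [privateBelief_eq_posterior, posterior_le_posterior_iff (hprior _) (hprior _)
    ENNReal.toReal_nonneg ht.le, ENNReal.le_ofReal_iff_toReal_le hs.ne ht.le]

theorem lrUpperTail_eq (hprior : ∀ j, 0 < prior j) (hPX₁₀ : PX true ≪ PX false) {t : ℝ}
    (ht : 0 < t) : lrUpperTail PX t =
      (PX true).real
        {s | 1 - posterior (prior true) (prior false) t ≤ privateBelief prior PX s} := by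
  refine measureReal_congr ?_
  filter_upwards [hPX₁₀.ae_le (ae_signalLR_lt_top PX)] with s hs
  refine propext ?_
  change _ ≤ signalLR PX s ↔ _ ≤ privateBelief prior PX s
  rw [privateBelief_eq_posterior, one_sub_posterior (hprior _) (hprior _) ht,
    posterior_le_posterior_iff (hprior _) (hprior _) (inv_nonneg.2 ht.le) ENNReal.toReal_nonneg,
    ENNReal.ofReal_le_iff_le_toReal hs.ne]

theorem HasLinearTails.lrLowerTail_isTheta (htails : HasLinearTails prior PX)
    (hprior : ∀ j, 0 < prior j) : lrLowerTail PX =Θ[𝓟 (Set.Ioi 0)] fun t => min t 1 := by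
  refine isTheta_min_one_of_monotoneOn (fun s _ t _ hst => measureReal_mono fun x hx =>
    le_trans (Set.mem_ofPred.1 hx) (ENNReal.ofReal_le_ofReal hst)) (fun _ => measureReal_nonneg)
    (fun _ => measureReal_le_one) ?_
  refine EventuallyEq.trans_isTheta ?_
    (comp_posterior_isTheta (hprior false) (hprior true) htails.lower)
  filter_upwards [self_mem_nhdsWithin] with t ht
  exact lrLowerTail_eq hprior ht

theorem HasLinearTails.lrUpperTail_isTheta (htails : HasLinearTails prior PX)
    (hprior : ∀ j, 0 < prior j) (hPX₁₀ : PX true ≪ PX false) :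
    lrUpperTail PX =Θ[𝓟 (Set.Ioi 0)] fun t => min t 1 := by
  refine isTheta_min_one_of_monotoneOn (fun s hs t _ hst => measureReal_mono fun x hx =>
    le_trans (ENNReal.ofReal_le_ofReal (inv_anti₀ hs hst)) (Set.mem_ofPred.1 hx))
    (fun _ => measureReal_nonneg) (fun _ => measureReal_le_one) ?_
  refine EventuallyEq.trans_isTheta ?_
    (comp_posterior_isTheta (hprior true) (hprior false) htails.upper)
  filter_upwards [self_mem_nhdsWithin] with t ht
  exact lrUpperTail_eq hprior hPX₁₀ ht

end Tails

section ThresholdTest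

/-- The test that decides `1` iff the likelihood ratio of the signal exceeds `t`. -/
noncomputable def lrTest (PX : Bool → Measure S) (t : ℝ) (s : S) : Bool :=
  open Classical in decide (ENNReal.ofReal t < signalLR PX s)

/-- The probability under `H_j` that the likelihood ratio test with threshold `t` decides `b`. -/
noncomputable def lrTestProb (PX : Bool → Measure S) (t : ℝ) (j b : Bool) : ℝ :=
  (PX j).real {s | lrTest PX t s = b}

variable {PX : Bool → Measure S}

theorem measurable_lrTest (t : ℝ) : Measurable (lrTest PX t) :=
  measurable_to_bool <| by
    simpa [lrTest, Set.preimage] using measurableSet_lt measurable_const (measurable_signalLR PX)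

theorem lrTest_eq_true_iff {t : ℝ} {s : S} :
    lrTest PX t s = true ↔ ENNReal.ofReal t < signalLR PX s :=
  decide_eq_true_iff

theorem lrTest_eq_false_iff {t : ℝ} {s : S} :
    lrTest PX t s = false ↔ signalLR PX s ≤ ENNReal.ofReal t :=
  decide_eq_false_iff_not.trans not_lt

theorem lrTestProb_false_false (t : ℝ) : lrTestProb PX t false false = lrLowerTail PX t := by
  simp only [lrTestProb, lrLowerTail, lrTest_eq_false_iff]

variable [∀ j, IsProbabilityMeasure (PX j)]

theorem lrTestProb_add (t : ℝ) (j : Bool) :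
    lrTestProb PX t j true + lrTestProb PX t j false = 1 := by
  have hcompl : {s | lrTest PX t s = false} = {s | lrTest PX t s = true}ᶜ := by
    ext s
    simp
  rw [lrTestProb, lrTestProb, hcompl]
  exact probReal_add_probReal_compl (measurable_lrTest t (measurableSet_singleton true))

theorem lrTestProb_true_true_le {t : ℝ} : lrTestProb PX t true true ≤ lrUpperTail PX t⁻¹ := by
  rw [lrUpperTail, inv_inv]
  exact measureReal_mono fun s hs => (lrTest_eq_true_iff.1 hs).le

/- On the part of the event where `L_X` is at most `t / 2`, the bound `L_X ≤ t` is loose by a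
factor of two. -/
theorem half_mul_lrLowerTail_le (hPX₁₀ : PX true ≪ PX false) {t : ℝ} (ht : 0 < t) :
    t / 2 * lrLowerTail PX (t / 2) ≤
      t * lrTestProb PX t false false - lrTestProb PX t true false := by
  set A := {s | lrTest PX t s = false}
  set B := {s | lrTest PX (t / 2) s = false}
  have hBA : B ⊆ A := fun s hs => lrTest_eq_false_iff.2 <|
    (lrTest_eq_false_iff.1 hs).trans (ENNReal.ofReal_le_ofReal (half_le_self ht.le))
  have hsplit : ∀ j, (PX j).real (A \ B) = (PX j).real A - (PX j).real B := fun j =>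
    measureReal_sdiff hBA (measurable_lrTest _ (measurableSet_singleton false))
  have hdiff : (PX true).real (A \ B) ≤ t * (PX false).real (A \ B) :=
    real_true_le_mul PX hPX₁₀ ht.le fun s hs => lrTest_eq_false_iff.1 hs.1
  have hB : (PX true).real B ≤ t / 2 * (PX false).real B :=
    real_true_le_mul PX hPX₁₀ (half_pos ht).le fun s hs => lrTest_eq_false_iff.1 hs
  rw [hsplit, hsplit] at hdiff
  rw [← lrTestProb_false_false]
  change t / 2 * (PX false).real B ≤ t * (PX false).real A - (PX true).real A
  linarith

theorem half_lrUpperTail_le (hPX₁₀ : PX true ≪ PX false) {t : ℝ} (ht : 0 < t) :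
    1 / 2 * lrUpperTail PX (t⁻¹ / 2) ≤
      lrTestProb PX t true true - t * lrTestProb PX t false true := by
  set A := {s | lrTest PX t s = true}
  set B := {s | ENNReal.ofReal (t⁻¹ / 2)⁻¹ ≤ signalLR PX s} with hB_def
  have htwo : (t⁻¹ / 2)⁻¹ = 2 * t := by field_simp
  rw [htwo] at hB_def
  have hBA : B ⊆ A := fun s hs => lrTest_eq_true_iff.2 <|
    ((ENNReal.ofReal_lt_ofReal_iff (by positivity)).2 (by linarith)).trans_le (hB_def.subset hs)
  have hsplit : ∀ j, (PX j).real (A \ B) = (PX j).real A - (PX j).real B := fun j =>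
    measureReal_sdiff hBA (measurableSet_le measurable_const (measurable_signalLR PX))
  have hdiff : t * (PX false).real (A \ B) ≤ (PX true).real (A \ B) :=
    mul_le_real_true PX hPX₁₀ ht.le fun s hs => (lrTest_eq_true_iff.1 hs.1).le
  have hB : 2 * t * (PX false).real B ≤ (PX true).real B :=
    mul_le_real_true PX hPX₁₀ (by positivity) fun s hs => hB_def.subset hs
  rw [hsplit, hsplit] at hdiff
  change 1 / 2 * (PX true).real B ≤ (PX true).real A - t * (PX false).real A
  linarith

theorem lrTestProb_pos_of_absolutelyContinuous {i j : Bool} (hij : PX i ≪ PX j) {t : ℝ} {b : Bool}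
    (h : 0 < lrTestProb PX t i b) : 0 < lrTestProb PX t j b :=
  measureReal_nonneg.lt_of_ne' fun h₀ =>
    h.ne' ((measureReal_eq_zero_iff).2 (hij ((measureReal_eq_zero_iff).1 h₀)))

theorem HasLinearTails.lrTestProb_pos {prior : Bool → ℝ} (htails : HasLinearTails prior PX)
    (hprior : ∀ j, 0 < prior j) (hPX₁₀ : PX true ≪ PX false) (hPX₀₁ : PX false ≪ PX true) {t : ℝ}
    (ht : 0 < t) (j b : Bool) : 0 < lrTestProb PX t j b := by
  have hff : 0 < lrTestProb PX t false false := by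
    rw [lrTestProb_false_false]
    exact pos_of_isTheta_min_one (fun _ => measureReal_nonneg)
      (htails.lrLowerTail_isTheta hprior) ht
  have htt : 0 < lrTestProb PX t true true := by
    have hU : 0 < lrUpperTail PX (t⁻¹ / 2) := pos_of_isTheta_min_one (fun _ => measureReal_nonneg)
      (htails.lrUpperTail_isTheta hprior hPX₁₀) (by positivity)
    have hft : 0 ≤ t * lrTestProb PX t false true := mul_nonneg ht.le measureReal_nonneg
    linarith [half_lrUpperTail_le hPX₁₀ ht]
  cases j <;> cases b
  exacts [hff, lrTestProb_pos_of_absolutelyContinuous hPX₁₀ htt,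
    lrTestProb_pos_of_absolutelyContinuous hPX₀₁ hff, htt]

end ThresholdTest

section TandemLaw

variable (prior : Bool → ℝ) (PX : Bool → Measure S)

theorem measurable_privateTest : Measurable (privateTest prior PX) :=
  measurable_lrTest _

theorem measurable_relayTest (Q : Bool → Measure Bool) :
    Measurable fun p : S × Bool => relayTest prior PX Q p.1 p.2 :=
  measurable_from_prod_countable_left fun b => measurable_to_bool <| by
    simpa [relayTest, Set.preimage] using
      measurableSet_lt measurable_const
        ((measurable_signalLR PX).mul_const (Q true {b} / Q false {b}))

/-- The joint probability `P(θ = H_j, decision = b)` for the decision of the node that has `i`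
predecessors in a tandem network. -/
noncomputable def jointProb (i : ℕ) (j b : Bool) : ℝ :=
  prior j * (tandemLaw prior PX i j).real {b}

/-- The error probability of the node that has `i` predecessors in a tandem network. -/
noncomputable def tandemError (i : ℕ) : ℝ :=
  jointProb prior PX i false true + jointProb prior PX i true false

theorem tandemLaw_zero_real (j b : Bool) : (tandemLaw prior PX 0 j).real {b} =
    lrTestProb PX (prior false / prior true) j b := by
  rw [tandemLaw, map_measureReal_apply (measurable_privateTest prior PX)
    (measurableSet_singleton b)]
  rfl

variable [∀ j, IsProbabilityMeasure (PX j)]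

instance isProbabilityMeasure_tandemLaw (i : ℕ) (j : Bool) :
    IsProbabilityMeasure (tandemLaw prior PX i j) := by
  induction i with
  | zero => exact Measure.isProbabilityMeasure_map (measurable_privateTest prior PX).aemeasurable
  | succ i ih =>
    exact Measure.isProbabilityMeasure_map (measurable_relayTest prior PX _).aemeasurable

theorem tandemLaw_succ_real (i : ℕ) (j b : Bool) : (tandemLaw prior PX (i + 1) j).real {b} =
    ∑ c, (PX j).real {s | relayTest prior PX (tandemLaw prior PX i) s c = b} *
      (tandemLaw prior PX i j).real {c} := by
  have hmeas := measurable_relayTest prior PX (tandemLaw prior PX i)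
  rw [tandemLaw, map_measureReal_apply hmeas (measurableSet_singleton b), Measure.real,
    Measure.prod_apply_symm (hmeas (measurableSet_singleton b)), lintegral_fintype,
    ENNReal.toReal_sum fun c _ => by finiteness]
  simp only [ENNReal.toReal_mul]
  rfl

variable {prior PX}

theorem jointProb_add (i : ℕ) (j : Bool) :
    jointProb prior PX i j true + jointProb prior PX i j false = prior j := by
  have h : ∑ b, (tandemLaw prior PX i j).real {b} = 1 := by
    rw [sum_measureReal_singleton, Finset.coe_univ, probReal_univ]
  rw [Fintype.sum_bool] at h
  rw [jointProb, jointProb, ← mul_add, h, mul_one]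

theorem relayTest_eq_lrTest (hprior : ∀ j, 0 < prior j) {i : ℕ} {c : Bool}
    (hpos : ∀ j, 0 < jointProb prior PX i j c) (s : S) :
    relayTest prior PX (tandemLaw prior PX i) s c =
      lrTest PX (jointProb prior PX i false c / jointProb prior PX i true c) s := by
  have hQ : ∀ j, 0 < (tandemLaw prior PX i j).real {c} := fun j =>
    (pos_iff_pos_of_mul_pos (hpos j)).1 (hprior j)
  have hratio := div_pos (hQ true) (hQ false)
  rw [relayTest, lrTest, mapThreshold, ← ofReal_measureReal, ← ofReal_measureReal,
    ← ENNReal.ofReal_div_of_pos (hQ false)]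
  simp only [← ENNReal.div_lt_iff (Or.inl (ENNReal.ofReal_pos.2 hratio).ne')
    (Or.inl ENNReal.ofReal_ne_top), ← ENNReal.ofReal_div_of_pos hratio, div_div_div_eq, jointProb]
  congr

theorem jointProb_succ (hprior : ∀ j, 0 < prior j) {i : ℕ}
    (hpos : ∀ j c, 0 < jointProb prior PX i j c) (j b : Bool) :
    jointProb prior PX (i + 1) j b =
      ∑ c, lrTestProb PX (jointProb prior PX i false c / jointProb prior PX i true c) j b *
        jointProb prior PX i j c := by
  rw [jointProb, tandemLaw_succ_real, Finset.mul_sum]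
  refine Finset.sum_congr rfl fun c _ => ?_
  simp only [relayTest_eq_lrTest hprior fun j => hpos j c]
  exact mul_left_comm _ _ _

theorem HasLinearTails.jointProb_pos (htails : HasLinearTails prior PX)
    (hprior : ∀ j, 0 < prior j) (hPX₁₀ : PX true ≪ PX false) (hPX₀₁ : PX false ≪ PX true) (i : ℕ)
    (j b : Bool) : 0 < jointProb prior PX i j b := by
  induction i generalizing j b with
  | zero =>
    rw [jointProb, tandemLaw_zero_real]
    exact mul_pos (hprior j) (htails.lrTestProb_pos hprior hPX₁₀ hPX₀₁
      (div_pos (hprior false) (hprior true)) j b)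
  | succ i ih =>
    rw [jointProb_succ hprior ih]
    exact Finset.sum_pos (fun c _ => mul_pos (htails.lrTestProb_pos hprior hPX₁₀ hPX₀₁
      (div_pos (ih false c) (ih true c)) j b) (ih j c)) Finset.univ_nonempty

theorem tandemError_sub_succ (hprior : ∀ j, 0 < prior j) {i : ℕ}
    (hpos : ∀ j c, 0 < jointProb prior PX i j c) :
    tandemError prior PX i - tandemError prior PX (i + 1) =
      (jointProb prior PX i false true * lrTestProb PX
          (jointProb prior PX i false true / jointProb prior PX i true true) false false -
        jointProb prior PX i true true * lrTestProb PX
          (jointProb prior PX i false true / jointProb prior PX i true true) true false) +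
      (jointProb prior PX i true false * lrTestProb PX
          (jointProb prior PX i false false / jointProb prior PX i true false) true true -
        jointProb prior PX i false false * lrTestProb PX
          (jointProb prior PX i false false / jointProb prior PX i true false) false true) := by
  rw [tandemError, tandemError, jointProb_succ hprior hpos, jointProb_succ hprior hpos,
    Fintype.sum_bool, Fintype.sum_bool]
  linear_combination (-jointProb prior PX i false true) * lrTestProb_add (PX := PX)
    (jointProb prior PX i false true / jointProb prior PX i true true) false -
    jointProb prior PX i true false * lrTestProb_add (PX := PX)
    (jointProb prior PX i false false / jointProb prior PX i true false) true

end TandemLaw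

section TandemError

/- Here `x` is the joint probability of an error, `y` that of the same decision being correct and
`z` that of the other error; `x / y` is the threshold by which the next node corrects the error,
and `F` the tail probability of such a correction. -/
theorem exists_gain_bounds {F : ℝ → ℝ} (hF0 : ∀ t, 0 ≤ F t)
    (hF : F =Θ[𝓟 (Set.Ioi 0)] fun t => min t 1) {p : ℝ} (hp : 0 < p) :
    ∃ c C, 0 < c ∧ 0 < C ∧ ∀ x y z, 0 < x → x ≤ 1 → 0 < y → y ≤ 1 → 0 ≤ z → y + z = p →
      Set.Icc (x * (1 / 2 * F (x / y / 2))) (x * F (x / y)) ⊆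
        Set.Icc (c * x ^ 2) (C * (x * (x + z))) := by
  obtain ⟨c, C, hc, hC, hbound⟩ := (isTheta_iff_exists_bounds (.of_forall hF0)
    (eventually_principal.2 fun t ht => le_min (Set.mem_Ioi.1 ht).le one_pos.le)).1 hF
  rw [eventually_principal] at hbound
  refine ⟨c / 4, C / p, by positivity, by positivity,
    fun x y z hx hx1 hy hy1 hz hyz => Set.Icc_subset_Icc ?_ ?_⟩
  · have hmin : x / 2 ≤ min (x / y / 2) 1 :=
      le_min (by gcongr; exact le_div_self hx.le hy hy1) (by linarith)
    calc c / 4 * x ^ 2 = x * (1 / 2 * (c * (x / 2))) := by ring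
      _ ≤ x * (1 / 2 * (c * min (x / y / 2) 1)) := by gcongr
      _ ≤ x * (1 / 2 * F (x / y / 2)) := by
        gcongr
        exact (hbound _ (Set.mem_Ioi.2 (by positivity))).1
  · have hmin : min (x / y) 1 ≤ (x + z) / p := by
      rw [le_div_iff₀ hp, ← hyz, mul_add]
      refine add_le_add ?_ (mul_le_of_le_one_left hz (min_le_right _ _))
      exact (mul_le_mul_of_nonneg_right (min_le_left _ _) hy.le).trans_eq (div_mul_cancel₀ x hy.ne')
    calc x * F (x / y) ≤ x * (C * min (x / y) 1) := by
          gcongr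
          exact (hbound _ (Set.mem_Ioi.2 (by positivity))).2
      _ ≤ x * (C * ((x + z) / p)) := by gcongr
      _ = C / p * (x * (x + z)) := by ring

variable {prior : Bool → ℝ} {PX : Bool → Measure S} [∀ j, IsProbabilityMeasure (PX j)]

theorem lrLowerTail_gain_bounds (hPX₁₀ : PX true ≪ PX false) {x y : ℝ} (hx : 0 < x) (hy : 0 < y) :
    x * lrTestProb PX (x / y) false false - y * lrTestProb PX (x / y) true false ∈
      Set.Icc (x * (1 / 2 * lrLowerTail PX (x / y / 2))) (x * lrLowerTail PX (x / y)) := by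
  constructor
  · calc x * (1 / 2 * lrLowerTail PX (x / y / 2)) =
          y * (x / y / 2 * lrLowerTail PX (x / y / 2)) := by field_simp
      _ ≤ y * (x / y * lrTestProb PX (x / y) false false - lrTestProb PX (x / y) true false) :=
        mul_le_mul_of_nonneg_left (half_mul_lrLowerTail_le hPX₁₀ (div_pos hx hy)) hy.le
      _ = _ := by rw [mul_sub, ← mul_assoc, mul_div_cancel₀ x hy.ne']
  · rw [lrTestProb_false_false]
    exact sub_le_self _ (mul_nonneg hy.le measureReal_nonneg)

theorem lrUpperTail_gain_bounds (hPX₁₀ : PX true ≪ PX false) {x y : ℝ} (hx : 0 < x) (hy : 0 < y) :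
    x * lrTestProb PX (y / x) true true - y * lrTestProb PX (y / x) false true ∈
      Set.Icc (x * (1 / 2 * lrUpperTail PX (x / y / 2))) (x * lrUpperTail PX (x / y)) := by
  have hgain := mul_le_mul_of_nonneg_left (half_lrUpperTail_le hPX₁₀ (div_pos hy hx)) hx.le
  have hupper := mul_le_mul_of_nonneg_left
    (lrTestProb_true_true_le (PX := PX) (t := y / x)) hx.le
  rw [inv_div] at hgain hupper
  constructor
  · rwa [mul_sub, ← mul_assoc x (y / x), mul_div_cancel₀ y hx.ne'] at hgain
  · exact (sub_le_self _ (mul_nonneg hy.le measureReal_nonneg)).trans hupper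

theorem HasLinearTails.exists_tandemError_sub_succ_bounds (htails : HasLinearTails prior PX)
    (hprior : ∀ j, 0 < prior j) (hsum : prior false + prior true = 1)
    (hPX₁₀ : PX true ≪ PX false) (hPX₀₁ : PX false ≪ PX true) :
    ∃ c C, 0 < c ∧ ∀ i, tandemError prior PX i - tandemError prior PX (i + 1) ∈
      Set.Icc (c * tandemError prior PX i ^ 2) (C * tandemError prior PX i ^ 2) := by
  obtain ⟨c₀, C₀, hc₀, hC₀, hlower⟩ := exists_gain_bounds (F := lrLowerTail PX)
    (fun _ => measureReal_nonneg) (htails.lrLowerTail_isTheta hprior) (hprior true)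
  obtain ⟨c₁, C₁, hc₁, hC₁, hupper⟩ := exists_gain_bounds (F := lrUpperTail PX)
    (fun _ => measureReal_nonneg) (htails.lrUpperTail_isTheta hprior hPX₁₀) (hprior false)
  refine ⟨min c₀ c₁ / 2, C₀ + C₁, by positivity, fun i => ?_⟩
  have hpos := htails.jointProb_pos hprior hPX₁₀ hPX₀₁ i
  rw [tandemError_sub_succ hprior hpos, tandemError]
  have htrue := jointProb_add (prior := prior) (PX := PX) i true
  have hfalse := jointProb_add (prior := prior) (PX := PX) i false
  set x₀ := jointProb prior PX i false true
  set y₀ := jointProb prior PX i true true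
  set x₁ := jointProb prior PX i true false
  set y₁ := jointProb prior PX i false false
  have hx₀ : 0 < x₀ := hpos _ _
  have hy₀ : 0 < y₀ := hpos _ _
  have hx₁ : 0 < x₁ := hpos _ _
  have hy₁ : 0 < y₁ := hpos _ _
  obtain ⟨hl₀, hu₀⟩ := hlower x₀ y₀ x₁ hx₀ (by linarith) hy₀ (by linarith) hx₁.le htrue
    (lrLowerTail_gain_bounds hPX₁₀ hx₀ hy₀)
  obtain ⟨hl₁, hu₁⟩ := hupper x₁ y₁ x₀ hx₁ (by linarith) hy₁ (by linarith) hx₀.le (by linarith)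
    (lrUpperTail_gain_bounds hPX₁₀ hx₁ hy₁)
  constructor
  · calc min c₀ c₁ / 2 * (x₀ + x₁) ^ 2 ≤ min c₀ c₁ / 2 * (2 * (x₀ ^ 2 + x₁ ^ 2)) := by
          gcongr
          exact add_sq_le
      _ = min c₀ c₁ * x₀ ^ 2 + min c₀ c₁ * x₁ ^ 2 := by ring
      _ ≤ c₀ * x₀ ^ 2 + c₁ * x₁ ^ 2 := by
        gcongr
        exacts [min_le_left _ _, min_le_right _ _]
      _ ≤ _ := add_le_add hl₀ hl₁
  · calc _ ≤ C₀ * (x₀ * (x₀ + x₁)) + C₁ * (x₁ * (x₁ + x₀)) := add_le_add hu₀ hu₁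
      _ ≤ C₀ * ((x₀ + x₁) * (x₀ + x₁)) + C₁ * ((x₀ + x₁) * (x₁ + x₀)) := by
        gcongr <;> linarith
      _ = (C₀ + C₁) * (x₀ + x₁) ^ 2 := by ring

theorem HasLinearTails.tandemError_isTheta (htails : HasLinearTails prior PX)
    (hprior : ∀ j, 0 < prior j) (hsum : prior false + prior true = 1)
    (hPX₁₀ : PX true ≪ PX false) (hPX₀₁ : PX false ≪ PX true) :
    tandemError prior PX =Θ[⊤] fun n : ℕ => ((n : ℝ) + 1)⁻¹ := by
  have hpos := htails.jointProb_pos hprior hPX₁₀ hPX₀₁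
  obtain ⟨c, C, hc, hdec⟩ := htails.exists_tandemError_sub_succ_bounds hprior hsum hPX₁₀ hPX₀₁
  exact isTheta_inv_add_one_of_quadratic_decrement
    (fun i => add_pos (hpos i false true) (hpos i true false)) hc hdec

end TandemError

section BackwardSearch

variable {er : ℕ → Bool} {n k : ℕ}

theorem latestUnerased_eq_some_iff {k' : ℕ} :
    latestUnerased er n k = some k' ↔ IsGreatest {i | i ∈ unerased er n k} k' := by
  unfold latestUnerased
  split_ifs with hne
  · have hmax : IsGreatest {i | i ∈ unerased er n k} _ := Finset.isGreatest_max' _ hne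
    rw [Option.some_inj]
    exact ⟨fun h => h ▸ hmax, fun h => hmax.unique h⟩
  · exact iff_of_false (by simp) fun h => hne ⟨k', h.1⟩

theorem latestUnerased_mem_Ico {k' : ℕ} (h : latestUnerased er n k = some k') :
    k' ∈ Finset.Ico (k - n) k :=
  (Finset.mem_filter.1 (latestUnerased_eq_some_iff.1 h).1).1

theorem lt_of_latestUnerased_eq_some {k' : ℕ} (h : latestUnerased er n k = some k') : k' < k :=
  (Finset.mem_Ico.1 (latestUnerased_mem_Ico h)).2

theorem backwardSearch_succ_eq_bind (i : ℕ) : backwardSearch er n k (i + 1) =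
    (latestUnerased er n k).bind fun k' => backwardSearch er n k' i := by
  induction i with
  | zero => simp [backwardSearch]
  | succ i ih =>
    rw [backwardSearch, ih, Option.bind_assoc]
    rfl

theorem dependsOn_latestUnerased (n k : ℕ) :
    DependsOn (fun er => latestUnerased er n k) (Set.Iio k) := fun er er' h => by
  have : unerased er n k = unerased er' n k :=
    Finset.filter_congr fun i hi => by rw [h i (Finset.mem_Ico.1 hi).2]
  simp only [latestUnerased, this]

theorem dependsOn_backwardSearch (n k i : ℕ) :
    DependsOn (fun er => backwardSearch er n k i) (Set.Iio k) := by
  induction i generalizing k with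
  | zero => exact fun _ _ _ => rfl
  | succ i ih =>
    intro er er' h
    simp only [backwardSearch_succ_eq_bind, ← dependsOn_latestUnerased n k h]
    refine Option.bind_congr fun k' hk' => ih k' fun l hl => h l ?_
    exact lt_trans hl (lt_of_latestUnerased_eq_some hk')

theorem dependsOn_hasTandem (n k : ℕ) : DependsOn (fun er => HasTandem er n k) (Set.Iio k) :=
  fun _ _ h => congrArg (fun o : Option ℕ => o.isSome = true) (dependsOn_backwardSearch n k n h)

theorem dependsOn_tandemDecision (prior : Bool → ℝ) (PX : Bool → Measure S) (x : ℕ → S)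
    (n i k : ℕ) : DependsOn (fun er => tandemDecision prior PX x er n i k) (Set.Iio k) := by
  induction i generalizing k with
  | zero => exact fun _ _ _ => rfl
  | succ i ih =>
    intro er er' h
    simp only [tandemDecision, ← dependsOn_latestUnerased n k h]
    cases hk' : latestUnerased er n k with
    | none => rfl
    | some k' =>
      have hdecision := ih k' fun l hl => h l (lt_trans hl (lt_of_latestUnerased_eq_some hk'))
      exact congrArg (relayTest prior PX (tandemLaw prior PX i) (x k)) hdecision

end BackwardSearch

section Measurability

theorem measurable_uncurry_of_dependsOn {α β ι κ : Type*} [MeasurableSpace α] [MeasurableSpace β]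
    [MeasurableSpace κ] [MeasurableSingletonClass κ] [Finite κ] {s : Set ι} (hs : s.Finite)
    {f : α → (ι → κ) → β} (hmeas : ∀ y, Measurable fun x => f x y)
    (hdep : ∀ x, DependsOn (f x) s) : Measurable (Function.uncurry f) := by
  classical
  have := hs.to_subtype
  rcases isEmpty_or_nonempty (ι → κ) with _ | ⟨⟨y₀⟩⟩
  · exact measurable_of_empty _
  · let extend (z : s → κ) : ι → κ := fun i => if h : i ∈ s then z ⟨i, h⟩ else y₀ i
    have hfactor : Function.uncurry f =
        (fun p : α × (s → κ) => f p.1 (extend p.2)) ∘ Prod.map id s.domRestrict :=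
      funext fun p => hdep p.1 fun i hi => by simp [extend, hi, Set.domRestrict]
    rw [hfactor]
    exact (measurable_from_prod_countable_left fun z => hmeas (extend z)).comp
      (measurable_id.prodMap (measurable_pi_lambda _ fun i => measurable_pi_apply i.1))

theorem measurableSet_hasTandem (n k : ℕ) : MeasurableSet {er : ℕ → Bool | HasTandem er n k} := by
  have h : Measurable (Function.uncurry fun (_ : Unit) (er : ℕ → Bool) => HasTandem er n k) :=
    measurable_uncurry_of_dependsOn (Set.finite_Iio k) (fun _ => measurable_const)
      fun _ => dependsOn_hasTandem n k
  exact measurableSet_setOfPred.2 (h.comp (measurable_prodMk_left (x := ())))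

variable {Ω : Type*}

theorem measurable_tandemDecision_iSup_comap (prior : Bool → ℝ) (PX : Bool → Measure S)
    (X : ℕ → Ω → S) (er : ℕ → Bool) (n i k : ℕ) :
    Measurable[⨆ l ∈ Set.Iic k, MeasurableSpace.comap (X l) inferInstance]
      fun ω => tandemDecision prior PX (fun l => X l ω) er n i k := by
  have hX : ∀ k, Measurable[⨆ l ∈ Set.Iic k, MeasurableSpace.comap (X l) inferInstance] (X k) :=
    fun k => (comap_measurable (X k)).mono
      (le_biSup (fun l => MeasurableSpace.comap (X l) inferInstance) Set.self_mem_Iic) le_rfl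
  induction i generalizing k with
  | zero => exact (measurable_privateTest prior PX).comp (hX k)
  | succ i ih =>
    simp only [tandemDecision]
    cases h : latestUnerased er n k with
    | none => exact (measurable_privateTest prior PX).comp (hX k)
    | some k' =>
      have hk' : Set.Iic k' ⊆ Set.Iic k :=
        Set.Iic_subset_Iic.2 (lt_of_latestUnerased_eq_some h).le
      exact (measurable_relayTest prior PX (tandemLaw prior PX i)).comp
        ((hX k).prodMk ((ih k').mono (biSup_mono hk') le_rfl))

theorem measurable_tandemDecision_of_erasures (prior : Bool → ℝ) (PX : Bool → Measure S)
    (er : ℕ → Bool) (n i k : ℕ) :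
    Measurable fun x : ℕ → S => tandemDecision prior PX x er n i k :=
  (measurable_tandemDecision_iSup_comap prior PX (fun l (x : ℕ → S) => x l) er n i k).mono
    (iSup₂_le fun l _ => (measurable_pi_apply l).comap_le) le_rfl

theorem measurable_uncurry_tandemDecision (prior : Bool → ℝ) (PX : Bool → Measure S) (n i k : ℕ) :
    Measurable fun p : (ℕ → S) × (ℕ → Bool) => tandemDecision prior PX p.1 p.2 n i k :=
  measurable_uncurry_of_dependsOn (Set.finite_Iio k)
    (fun er => measurable_tandemDecision_of_erasures prior PX er n i k)
    fun x => dependsOn_tandemDecision prior PX x n i k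

end Measurability

section DecisionLaw

theorem measure_of_indepFun_of_section_eq {Ω α β : Type*} [MeasurableSpace Ω]
    [MeasurableSpace α] [MeasurableSpace β] {μ : Measure Ω} [IsFiniteMeasure μ] {X : Ω → α}
    {Y : Ω → β} (hX : Measurable X) (hY : Measurable Y) (hXY : IndepFun X Y μ) {H : Set β}
    (hH : MeasurableSet H) {B : Set (α × β)} (hB : MeasurableSet B) {r : ℝ≥0∞}
    (hr : ∀ y ∈ H, μ {ω | (X ω, y) ∈ B} = r) :
    μ {ω | Y ω ∈ H ∧ (X ω, Y ω) ∈ B} = r * μ {ω | Y ω ∈ H} := by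
  have hpair := (indepFun_iff_map_prod_eq_prod_map_map hX.aemeasurable hY.aemeasurable).1 hXY
  have hHB : MeasurableSet (Prod.snd ⁻¹' H ∩ B) := (measurable_snd hH).inter hB
  have hsection : ∀ y, μ.map X ((fun x => (x, y)) ⁻¹' (Prod.snd ⁻¹' H ∩ B)) =
      H.indicator (fun _ => r) y := fun y => by
    rw [Measure.map_apply hX (measurable_prodMk_right hHB)]
    by_cases hy : y ∈ H
    · rw [Set.indicator_of_mem hy, ← hr y hy]
      exact congrArg μ (Set.ext fun ω => and_iff_right hy)
    · rw [Set.indicator_of_notMem hy, ← measure_empty (μ := μ)]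
      exact congrArg μ (Set.eq_empty_of_forall_notMem fun ω hω => hy hω.1)
  calc μ {ω | Y ω ∈ H ∧ (X ω, Y ω) ∈ B}
    _ = μ.map (fun ω => (X ω, Y ω)) (Prod.snd ⁻¹' H ∩ B) :=
      (Measure.map_apply (hX.prodMk hY) hHB).symm
    _ = r * μ.map Y H := by
      rw [hpair, Measure.prod_apply_symm hHB, lintegral_congr hsection,
        lintegral_indicator_const hH]
    _ = r * μ {ω | Y ω ∈ H} := by
      rw [Measure.map_apply hY hH]
      rfl

variable {Ω : Type*} [MeasurableSpace Ω] {prior : Bool → ℝ} {PX : Bool → Measure S}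
  {P : Bool → Measure Ω} {q : ℕ → ℝ} {X : ℕ → Ω → S} {Z : ℕ → Ω → Bool}

theorem IsModel.measurable_tandemDecision (hmodel : IsModel P PX q X Z) (er : ℕ → Bool)
    (n i k : ℕ) : Measurable fun ω => tandemDecision prior PX (fun l => X l ω) er n i k :=
  (measurable_tandemDecision_of_erasures prior PX er n i k).comp
    (measurable_pi_lambda _ hmodel.measurable_signal)

theorem IsModel.indepFun_signal_tandemDecision (hmodel : IsModel P PX q X Z) (j : Bool)
    (er : ℕ → Bool) (n i : ℕ) {k k' : ℕ} (hk : k' < k) :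
    IndepFun (X k) (fun ω => tandemDecision prior PX (fun l => X l ω) er n i k') (P j) := by
  have hindep := indep_iSup_of_disjoint (fun l => (hmodel.measurable_signal l).comap_le)
    (hmodel.indep_signal j).iIndep (S := {k}) (T := Set.Iic k') (by simpa using hk)
  rw [iSup_singleton] at hindep
  exact (IndepFun_iff_Indep _ _ _).2 <| indep_of_indep_of_le_right hindep
    (measurable_tandemDecision_iSup_comap prior PX X er n i k').comap_le

variable [∀ j, IsProbabilityMeasure (P j)]

theorem IsModel.map_tandemDecision (hmodel : IsModel P PX q X Z) (j : Bool) {er : ℕ → Bool}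
    {n i k : ℕ} (h : (backwardSearch er n k i).isSome) (hk : i * n < k) :
    (P j).map (fun ω => tandemDecision prior PX (fun l => X l ω) er n i k) =
      tandemLaw prior PX i j := by
  induction i generalizing k with
  | zero =>
    simp only [tandemLaw]
    rw [← hmodel.signal_law j k (by omega),
      Measure.map_map (measurable_privateTest prior PX) (hmodel.measurable_signal k)]
    rfl
  | succ i ih =>
    rw [backwardSearch_succ_eq_bind] at h
    cases hk' : latestUnerased er n k with
    | none => simp [hk'] at h
    | some k' =>
      rw [hk'] at h
      have hX := hmodel.measurable_signal k
      have hdecision := hmodel.measurable_tandemDecision (prior := prior) er n i k'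
      have hlaw := ih (k := k') h <| by
        have := Finset.mem_Ico.1 (latestUnerased_mem_Ico hk')
        rw [Nat.succ_mul] at hk
        omega
      have hpair := (indepFun_iff_map_prod_eq_prod_map_map hX.aemeasurable
        hdecision.aemeasurable).1 (hmodel.indepFun_signal_tandemDecision j er n i
          (lt_of_latestUnerased_eq_some hk'))
      rw [hmodel.signal_law j k (by omega), hlaw] at hpair
      simp only [tandemDecision, hk', tandemLaw]
      rw [← hpair, Measure.map_map (measurable_relayTest prior PX _) (hX.prodMk hdecision)]
      rfl

theorem IsModel.real_hasTandem_and_tandemDecision_eq (hmodel : IsModel P PX q X Z) (j b : Bool)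
    {n k : ℕ} (hk : n ^ 2 < k) :
    (P j).real {ω | HasTandem (fun i => Z i ω) n k ∧
        tandemDecision prior PX (fun i => X i ω) (fun i => Z i ω) n n k = b} =
      (tandemLaw prior PX n j).real {b} * (P j).real {ω | HasTandem (fun i => Z i ω) n k} := by
  have hX : Measurable fun ω k => X k ω := measurable_pi_lambda _ hmodel.measurable_signal
  have hZ : Measurable fun ω k => Z k ω := measurable_pi_lambda _ hmodel.measurable_erasure
  have hlaw : ∀ er ∈ {er | HasTandem er n k},
      P j {ω | tandemDecision prior PX (fun i => X i ω) er n n k = b} =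
        tandemLaw prior PX n j {b} := fun er her => by
    rw [← hmodel.map_tandemDecision j her (by rwa [← sq]),
      Measure.map_apply (hmodel.measurable_tandemDecision er n n k) (measurableSet_singleton b)]
    rfl
  rw [Measure.real, Measure.real, Measure.real, ← ENNReal.toReal_mul]
  exact congrArg ENNReal.toReal <| measure_of_indepFun_of_section_eq hX hZ
    (hmodel.indep_signal_erasure j) (measurableSet_hasTandem n k)
    (measurable_uncurry_tandemDecision prior PX n n k (measurableSet_singleton b)) hlaw

end DecisionLaw

section SearchSuccess

section Deterministic

variable {er : ℕ → Bool} {n k : ℕ}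

theorem exists_latestUnerased (h : ∃ i ∈ Finset.Ico (k - n) k, er i = false) :
    ∃ k', latestUnerased er n k = some k' :=
  have hne : (unerased er n k).Nonempty := h.imp fun _ hi => Finset.mem_filter.2 hi
  ⟨_, dif_pos hne⟩

theorem latestUnerased_eq_pred (hn : 0 < n) (hk : 0 < k) (h : er (k - 1) = false) :
    latestUnerased er n k = some (k - 1) := by
  have hmem : k - 1 ∈ Finset.Ico (k - n) k := Finset.mem_Ico.2 ⟨by omega, by omega⟩
  exact latestUnerased_eq_some_iff.2 ⟨Finset.mem_filter.2 ⟨hmem, h⟩,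
    fun i hi => Nat.le_pred_of_lt (Finset.mem_Ico.1 (Finset.mem_filter.1 hi).1).2⟩

theorem hasTandem_of_forall_unerased (hnk : n ≤ k)
    (h : ∀ i ∈ Finset.Ico (k - n) k, er i = false) : HasTandem er n k := by
  have hsearch : ∀ i ≤ n, backwardSearch er n k i = some (k - i) := fun i => by
    induction i with
    | zero => exact fun _ => rfl
    | succ i ih =>
      intro hi
      have hpred : er (k - i - 1) = false := h (k - i - 1) (Finset.mem_Ico.2 ⟨by omega, by omega⟩)
      rw [backwardSearch, ih (by omega), Option.bind_some,
        latestUnerased_eq_pred (by omega) (by omega) hpred, Nat.sub_sub]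
  exact (congrArg Option.isSome (hsearch n le_rfl)).trans Option.isSome_some

theorem hasTandem_of_forall_exists_unerased (hnk : n ^ 2 ≤ k)
    (h : ∀ l ∈ Finset.Icc (k - n ^ 2 + n) k, ∃ i ∈ Finset.Ico (l - n) l, er i = false) :
    HasTandem er n k := by
  have hsearch : ∀ i ≤ n, ∃ k' ∈ Finset.Icc (k - i * n) k, backwardSearch er n k i = some k' := by
    intro i
    induction i with
    | zero => exact fun _ => ⟨k, by simp, rfl⟩
    | succ i ih =>
      intro hi
      obtain ⟨k', hk', hsearch⟩ := ih (by omega)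
      have hlast : (i + 1) * n ≤ n ^ 2 := sq n ▸ Nat.mul_le_mul_right n hi
      rw [Finset.mem_Icc] at hk'
      rw [Nat.succ_mul] at hlast ⊢
      obtain ⟨k'', hk''⟩ := exists_latestUnerased (h k' (Finset.mem_Icc.2 (by omega)))
      have hnext := Finset.mem_Ico.1 (latestUnerased_mem_Ico hk'')
      refine ⟨k'', Finset.mem_Icc.2 (by omega), ?_⟩
      rw [backwardSearch, hsearch, Option.bind_some, hk'']
  obtain ⟨k', -, hk'⟩ := hsearch n le_rfl
  exact (congrArg Option.isSome hk').trans Option.isSome_some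

end Deterministic

variable {Ω : Type*} [MeasurableSpace Ω] {PX : Bool → Measure S} {P : Bool → Measure Ω}
  {q : ℕ → ℝ} {X : ℕ → Ω → S} {Z : ℕ → Ω → Bool} {ε : ℝ}

theorem IsModel.erasure_prob_nonneg (hmodel : IsModel P PX q X Z) {k : ℕ} (hk : 1 ≤ k) :
    0 ≤ q k :=
  hmodel.erasure_prob false k hk ▸ measureReal_nonneg

theorem IsModel.real_forall_erasure_eq (hmodel : IsModel P PX q X Z) (j b : Bool) (s : Finset ℕ) :
    (P j).real {ω | ∀ i ∈ s, Z i ω = b} = ∏ i ∈ s, (P j).real {ω | Z i ω = b} := by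
  have hinter : {ω | ∀ i ∈ s, Z i ω = b} = ⋂ i ∈ s, Z i ⁻¹' {b} := by
    ext ω
    simp
  rw [measureReal_def, hinter, (hmodel.indep_erasure j).measure_inter_preimage_eq_mul s
    (sets := fun _ => {b}) fun _ _ => measurableSet_singleton b, ENNReal.toReal_prod]
  rfl

theorem IsModel.real_forall_erased_le (hmodel : IsModel P PX q X Z)
    (hq : ∀ k, 1 ≤ k → q k ≤ 1 - ε) (j : Bool) {s : Finset ℕ} (hs : ∀ i ∈ s, 1 ≤ i) :
    (P j).real {ω | ∀ i ∈ s, Z i ω = true} ≤ (1 - ε) ^ s.card := by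
  rw [hmodel.real_forall_erasure_eq, ← Finset.prod_const]
  refine Finset.prod_le_prod (fun _ _ => measureReal_nonneg) fun i hi => ?_
  rw [hmodel.erasure_prob j i (hs i hi)]
  exact hq i (hs i hi)

theorem IsModel.measurableSet_hasTandem (hmodel : IsModel P PX q X Z) (n k : ℕ) :
    MeasurableSet {ω | HasTandem (fun i => Z i ω) n k} :=
  measurable_pi_lambda _ hmodel.measurable_erasure (ErasureNetwork.measurableSet_hasTandem n k)

variable [∀ j, IsProbabilityMeasure (P j)]

theorem IsModel.real_unerased (hmodel : IsModel P PX q X Z) (j : Bool) {k : ℕ} (hk : 1 ≤ k) :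
    (P j).real {ω | Z k ω = false} = 1 - q k := by
  have hcompl : {ω | Z k ω = false} = (Z k ⁻¹' {true})ᶜ := by
    ext ω
    simp
  rw [← hmodel.erasure_prob j k hk, hcompl]
  exact probReal_compl_eq_one_sub (hmodel.measurable_erasure k (measurableSet_singleton true))

theorem IsModel.le_real_forall_unerased (hmodel : IsModel P PX q X Z) (hε : 0 ≤ ε)
    (hq : ∀ k, 1 ≤ k → q k ≤ 1 - ε) (j : Bool) {s : Finset ℕ} (hs : ∀ i ∈ s, 1 ≤ i) :
    ε ^ s.card ≤ (P j).real {ω | ∀ i ∈ s, Z i ω = false} := by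
  rw [hmodel.real_forall_erasure_eq, ← Finset.prod_const]
  refine Finset.prod_le_prod (fun _ _ => hε) fun i hi => ?_
  rw [hmodel.real_unerased j (hs i hi)]
  exact le_sub_comm.1 (hq i (hs i hi))

theorem IsModel.pow_le_real_hasTandem (hmodel : IsModel P PX q X Z) (hε : 0 ≤ ε)
    (hq : ∀ k, 1 ≤ k → q k ≤ 1 - ε) (j : Bool) {n k : ℕ} (hnk : n < k) :
    ε ^ n ≤ (P j).real {ω | HasTandem (fun i => Z i ω) n k} := by
  have hcard : (Finset.Ico (k - n) k).card = n := by rw [Nat.card_Ico, Nat.sub_sub_self hnk.le]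
  calc ε ^ n = ε ^ (Finset.Ico (k - n) k).card := by rw [hcard]
    _ ≤ (P j).real {ω | ∀ i ∈ Finset.Ico (k - n) k, Z i ω = false} :=
      hmodel.le_real_forall_unerased hε hq j fun i hi =>
        (Nat.sub_pos_of_lt hnk).trans_le (Finset.mem_Ico.1 hi).1
    _ ≤ _ := measureReal_mono fun ω hω => hasTandem_of_forall_unerased hnk.le hω

theorem IsModel.real_not_hasTandem_le (hmodel : IsModel P PX q X Z)
    (hq : ∀ k, 1 ≤ k → q k ≤ 1 - ε) (j : Bool) {n k : ℕ} (hnk : n ^ 2 < k) :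
    (P j).real {ω | ¬ HasTandem (fun i => Z i ω) n k} ≤ (n ^ 2 + 1) * (1 - ε) ^ n := by
  have hε : 0 ≤ 1 - ε := (hmodel.erasure_prob_nonneg le_rfl).trans (hq 1 le_rfl)
  have : n ≤ n ^ 2 := Nat.le_self_pow two_ne_zero n
  have hrun : ∀ l ∈ Finset.Icc (k - n ^ 2 + n) k,
      (P j).real {ω | ∀ i ∈ Finset.Ico (l - n) l, Z i ω = true} ≤ (1 - ε) ^ n := fun l hl => by
    rw [Finset.mem_Icc] at hl
    have hcard : (Finset.Ico (l - n) l).card = n := by rw [Nat.card_Ico]; omega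
    refine (hmodel.real_forall_erased_le hq j fun i hi => ?_).trans_eq (by rw [hcard])
    have := Finset.mem_Ico.1 hi
    omega
  calc (P j).real {ω | ¬ HasTandem (fun i => Z i ω) n k}
    _ ≤ (P j).real (⋃ l ∈ Finset.Icc (k - n ^ 2 + n) k,
        {ω | ∀ i ∈ Finset.Ico (l - n) l, Z i ω = true}) := by
      refine measureReal_mono (fun ω hω => ?_) (measure_ne_top _ _)
      by_contra hrun
      refine hω (hasTandem_of_forall_exists_unerased hnk.le fun l hl => ?_)
      by_contra! herased
      exact hrun (Set.mem_biUnion hl fun i hi => Bool.not_eq_false _ ▸ herased i hi)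
    _ ≤ ∑ l ∈ Finset.Icc (k - n ^ 2 + n) k,
        (P j).real {ω | ∀ i ∈ Finset.Ico (l - n) l, Z i ω = true} :=
      measureReal_biUnion_finset_le _ _
    _ ≤ (Finset.Icc (k - n ^ 2 + n) k).card * (1 - ε) ^ n := by
      rw [← nsmul_eq_mul]
      exact Finset.sum_le_card_nsmul _ _ _ hrun
    _ ≤ (n ^ 2 + 1) * (1 - ε) ^ n := by
      rw [Nat.card_Icc]
      gcongr
      exact_mod_cast (by omega : k + 1 - (k - n ^ 2 + n) ≤ n ^ 2 + 1)

theorem IsModel.exists_mul_real_not_hasTandem_le (hmodel : IsModel P PX q X Z) (hε : 0 < ε)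
    (hq : ∀ k, 1 ≤ k → q k ≤ 1 - ε) :
    ∃ M : ℝ, ∀ (j : Bool) (n k : ℕ), n ^ 2 < k →
      (n + 1) * (P j).real {ω | ¬ HasTandem (fun i => Z i ω) n k} ≤ M := by
  have hr : 0 ≤ 1 - ε := (hmodel.erasure_prob_nonneg le_rfl).trans (hq 1 le_rfl)
  have hpow := fun a => tendsto_pow_const_mul_const_pow_of_lt_one a hr (by linarith)
  have hlim : Tendsto (fun n : ℕ => ((n : ℝ) + 1) * ((n ^ 2 + 1) * (1 - ε) ^ n)) atTop
      (𝓝 (0 + 0 + 0 + 0)) :=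
    ((((hpow 3).add (hpow 2)).add (hpow 1)).add (hpow 0)).congr fun n => by ring
  obtain ⟨M, hM⟩ := hlim.bddAbove_range
  refine ⟨M, fun j n k hnk => le_trans ?_ (hM (Set.mem_range_self n))⟩
  gcongr
  exact hmodel.real_not_hasTandem_le hq j hnk

theorem IsModel.exists_pos_le_real_hasTandem (hmodel : IsModel P PX q X Z) (hε : 0 < ε)
    (hq : ∀ k, 1 ≤ k → q k ≤ 1 - ε) :
    ∃ p : ℝ, 0 < p ∧ ∀ (j : Bool) (n k : ℕ), n ^ 2 < k →
      p ≤ (P j).real {ω | HasTandem (fun i => Z i ω) n k} := by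
  obtain ⟨M, hM⟩ := hmodel.exists_mul_real_not_hasTandem_le hε hq
  have hε1 : ε ≤ 1 := sub_nonneg.1 ((hmodel.erasure_prob_nonneg le_rfl).trans (hq 1 le_rfl))
  obtain ⟨N, hN⟩ := exists_nat_ge (2 * M)
  refine ⟨min (ε ^ N) (1 / 2), by positivity, fun j n k hnk => ?_⟩
  rcases le_total n N with hnN | hNn
  · exact (min_le_left _ _).trans <| (pow_le_pow_of_le_one hε.le hε1 hnN).trans <|
      hmodel.pow_le_real_hasTandem hε.le hq j ((Nat.le_self_pow two_ne_zero n).trans_lt hnk)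
  · have hcompl : (P j).real {ω | HasTandem (fun i => Z i ω) n k} +
        (P j).real {ω | ¬ HasTandem (fun i => Z i ω) n k} = 1 :=
      probReal_add_probReal_compl (hmodel.measurableSet_hasTandem n k)
    have hcast : (N : ℝ) ≤ n := Nat.cast_le.2 hNn
    have hfail : (P j).real {ω | ¬ HasTandem (fun i => Z i ω) n k} ≤ 1 / 2 := by
      nlinarith [hM j n k hnk]
    exact (min_le_right _ _).trans (by linarith)

end SearchSuccess

section ErrorProb

variable {Ω : Type*} [MeasurableSpace Ω] {prior : Bool → ℝ} {PX : Bool → Measure S}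
  {P : Bool → Measure Ω} {q : ℕ → ℝ} {X : ℕ → Ω → S} {Z : ℕ → Ω → Bool}

theorem errorProb_nonneg (hprior : ∀ j, 0 < prior j) (d : Ω → Bool) : 0 ≤ errorProb prior P d :=
  add_nonneg (mul_nonneg (hprior _).le measureReal_nonneg)
    (mul_nonneg (hprior _).le measureReal_nonneg)

theorem tandemError_nonneg (hprior : ∀ j, 0 < prior j) (n : ℕ) : 0 ≤ tandemError prior PX n :=
  add_nonneg (mul_nonneg (hprior _).le measureReal_nonneg)
    (mul_nonneg (hprior _).le measureReal_nonneg)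

variable [∀ j, IsProbabilityMeasure (P j)]

theorem IsModel.mul_real_hasTandem_le_real_decision (hmodel : IsModel P PX q X Z) {n k : ℕ}
    (hnk : n ^ 2 < k) {d : Ω → Bool} (hd : ∀ ω, HasTandem (fun i => Z i ω) n k →
      d ω = tandemDecision prior PX (fun i => X i ω) (fun i => Z i ω) n n k) (j b : Bool) :
    (tandemLaw prior PX n j).real {b} * (P j).real {ω | HasTandem (fun i => Z i ω) n k} ≤
      (P j).real {ω | d ω = b} := by
  rw [← hmodel.real_hasTandem_and_tandemDecision_eq j b hnk]
  exact measureReal_mono fun ω hω => (hd ω hω.1).trans hω.2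

theorem IsModel.real_decision_le (hmodel : IsModel P PX q X Z) {n k : ℕ}
    (hnk : n ^ 2 < k) {d : Ω → Bool} (hd : ∀ ω, HasTandem (fun i => Z i ω) n k →
      d ω = tandemDecision prior PX (fun i => X i ω) (fun i => Z i ω) n n k) (j b : Bool) :
    (P j).real {ω | d ω = b} ≤ (tandemLaw prior PX n j).real {b} +
      (P j).real {ω | ¬ HasTandem (fun i => Z i ω) n k} := by
  calc (P j).real {ω | d ω = b}
    _ ≤ (P j).real ({ω | HasTandem (fun i => Z i ω) n k ∧
          tandemDecision prior PX (fun i => X i ω) (fun i => Z i ω) n n k = b} ∪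
        {ω | ¬ HasTandem (fun i => Z i ω) n k}) :=
      measureReal_mono fun ω hω => or_iff_not_imp_right.2 fun h =>
        have hfound := not_not.1 h
        ⟨hfound, (hd ω hfound).symm.trans hω⟩
    _ ≤ _ := measureReal_union_le _ _
    _ ≤ _ := by
      gcongr
      rw [hmodel.real_hasTandem_and_tandemDecision_eq j b hnk]
      exact mul_le_of_le_one_right measureReal_nonneg measureReal_le_one

theorem IsModel.exists_mul_tandemError_le_errorProb (hmodel : IsModel P PX q X Z)
    (hprior : ∀ j, 0 < prior j) {ε : ℝ} (hε : 0 < ε) (hq : ∀ k, 1 ≤ k → q k ≤ 1 - ε) :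
    ∃ p : ℝ, 0 < p ∧ ∀ (n k : ℕ) (d : Ω → Bool), n ^ 2 < k →
      (∀ ω, HasTandem (fun i => Z i ω) n k →
        d ω = tandemDecision prior PX (fun i => X i ω) (fun i => Z i ω) n n k) →
      p * tandemError prior PX n ≤ errorProb prior P d := by
  obtain ⟨p, hp, hfound⟩ := hmodel.exists_pos_le_real_hasTandem hε hq
  refine ⟨p, hp, fun n k d hnk hd => ?_⟩
  have hdecision : ∀ j b, p * jointProb prior PX n j b ≤ prior j * (P j).real {ω | d ω = b} :=
    fun j b => by
      rw [jointProb, mul_left_comm, mul_comm p]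
      have := (hprior j).le
      gcongr
      refine le_trans ?_ (hmodel.mul_real_hasTandem_le_real_decision hnk hd j b)
      gcongr
      exact hfound j n k hnk
  rw [tandemError, mul_add]
  exact add_le_add (hdecision false true) (hdecision true false)

theorem IsModel.exists_errorProb_le_tandemError_add (hmodel : IsModel P PX q X Z)
    (hprior : ∀ j, 0 < prior j) {ε : ℝ} (hε : 0 < ε) (hq : ∀ k, 1 ≤ k → q k ≤ 1 - ε) :
    ∃ M : ℝ, ∀ (n k : ℕ) (d : Ω → Bool), n ^ 2 < k →
      (∀ ω, HasTandem (fun i => Z i ω) n k →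
        d ω = tandemDecision prior PX (fun i => X i ω) (fun i => Z i ω) n n k) →
      errorProb prior P d ≤ tandemError prior PX n + M * ((n : ℝ) + 1)⁻¹ := by
  obtain ⟨M, hfail⟩ := hmodel.exists_mul_real_not_hasTandem_le hε hq
  refine ⟨prior false * M + prior true * M, fun n k d hnk hd => ?_⟩
  have hdecision : ∀ j b, prior j * (P j).real {ω | d ω = b} ≤
      jointProb prior PX n j b + prior j * M * ((n : ℝ) + 1)⁻¹ := fun j b => by
    rw [jointProb, mul_assoc (prior j) M, ← mul_add]
    have := (hprior j).le
    gcongr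
    refine (hmodel.real_decision_le hnk hd j b).trans ?_
    gcongr
    exact (le_mul_inv_iff₀' (by positivity)).2 (hfail j n k hnk)
  calc errorProb prior P d ≤ _ := add_le_add (hdecision false true) (hdecision true false)
    _ = _ := by rw [tandemError]; ring

variable [∀ j, IsProbabilityMeasure (PX j)]

theorem IsModel.errorProb_isTheta (hmodel : IsModel P PX q X Z) (hprior : ∀ j, 0 < prior j)
    (hsum : prior false + prior true = 1) (hPX₁₀ : PX true ≪ PX false)
    (hPX₀₁ : PX false ≪ PX true) (htails : HasLinearTails prior PX) {ε : ℝ} (hε : 0 < ε)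
    (hq : ∀ k, 1 ≤ k → q k ≤ 1 - ε) {l : Filter ℕ} {n : ℕ → ℕ} (hn : ∀ᶠ k in l, n k ^ 2 < k)
    {d : ℕ → Ω → Bool} (hd : ∀ᶠ k in l, ∀ ω, HasTandem (fun i => Z i ω) (n k) k →
      d k ω = tandemDecision prior PX (fun i => X i ω) (fun i => Z i ω) (n k) (n k) k) :
    (fun k => errorProb prior P (d k)) =Θ[l] fun k => ((n k : ℝ) + 1)⁻¹ := by
  have htandem : (fun k => tandemError prior PX (n k)) =Θ[l] fun k => ((n k : ℝ) + 1)⁻¹ :=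
    have h := htails.tandemError_isTheta hprior hsum hPX₁₀ hPX₀₁
    ⟨h.1.comp_tendsto tendsto_top, h.2.comp_tendsto tendsto_top⟩
  constructor
  · obtain ⟨M, hM⟩ := hmodel.exists_errorProb_le_tandemError_add (PX := PX) hprior hε hq
    refine IsBigO.trans (.of_norm_eventuallyLE ?_)
      (htandem.1.add ((isBigO_refl _ l).const_mul_left M))
    filter_upwards [hn, hd] with k hnk hdk
    rw [Real.norm_of_nonneg (errorProb_nonneg hprior _)]
    exact hM _ _ _ hnk hdk
  · obtain ⟨p, hp, hle⟩ := hmodel.exists_mul_tandemError_le_errorProb (PX := PX) hprior hε hq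
    refine htandem.2.trans (.of_bound p⁻¹ ?_)
    filter_upwards [hn, hd] with k hnk hdk
    rw [Real.norm_of_nonneg (tandemError_nonneg hprior _),
      Real.norm_of_nonneg (errorProb_nonneg hprior _)]
    exact (le_inv_mul_iff₀ hp).2 (hle _ _ _ hnk hdk)

end ErrorProb

section TandemLength

variable {m : ℕ → ℕ} {k : ℕ} {σ : ℝ}

theorem tandemLength_sq_lt (hk : 1 ≤ k) : tandemLength m k ^ 2 < k :=
  (tandemLength_isGreatest m k hk).1.1

theorem tandemLength_le (hk : 1 ≤ k) : tandemLength m k ≤ m k :=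
  (tandemLength_isGreatest m k hk).1.2 k (Nat.sub_le _ _) le_rfl

theorem le_tandemLength {n : ℕ} (hnk : n ^ 2 < k)
    (hnm : ∀ i, k - n ^ 2 ≤ i → i ≤ k → n ≤ m i) : n ≤ tandemLength m k :=
  (tandemLength_isGreatest m k (Nat.zero_lt_of_lt hnk)).2 ⟨hnk, hnm⟩

theorem natCast_le_rpow_half_of_sq_le {n : ℕ} (hnk : n ^ 2 ≤ k) :
    (n : ℝ) ≤ (k : ℝ) ^ (1 / 2 : ℝ) := by
  rw [← Real.sqrt_eq_rpow]
  exact Real.le_sqrt_of_sq_le (by exact_mod_cast hnk)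

theorem nonneg_of_natCast_isTheta_rpow
    (hm : (fun k => (m k : ℝ)) =Θ[atTop] fun k : ℕ => (k : ℝ) ^ σ) : 0 ≤ σ := by
  by_contra! hσ
  have hrpow : Tendsto (fun k : ℕ => (k : ℝ) ^ σ) atTop (𝓝 0) := by
    simpa only [neg_neg, Function.comp_def] using
      (tendsto_rpow_neg_atTop (neg_pos.2 hσ)).comp tendsto_natCast_atTop_atTop
  have hlt : ∀ᶠ k in atTop, (m k : ℝ) < 1 :=
    (hm.tendsto_zero_iff.2 hrpow).eventually_lt_const one_pos
  obtain ⟨k, ⟨hmk, hiff⟩, hk⟩ := ((hlt.and hm.eq_zero_iff).and (eventually_ge_atTop 1)).exists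
  have hzero : (m k : ℝ) = 0 := by
    rw [Nat.cast_lt_one.1 hmk, Nat.cast_zero]
  exact (Real.rpow_pos_of_pos (Nat.cast_pos.2 hk) σ).ne' (hiff.1 hzero)

theorem isBigO_tandemLength (hm : (fun k => (m k : ℝ)) =O[atTop] fun k : ℕ => (k : ℝ) ^ σ) :
    (fun k => (tandemLength m k : ℝ)) =O[atTop] fun k : ℕ => (k : ℝ) ^ min σ (1 / 2) := by
  rcases min_choice σ (1 / 2) with hmin | hmin <;> rw [hmin]
  · refine IsBigO.trans (.of_norm_eventuallyLE ?_) hm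
    filter_upwards [eventually_ge_atTop 1] with k hk
    rw [Real.norm_natCast]
    exact Nat.cast_le.2 (tandemLength_le hk)
  · refine .of_norm_eventuallyLE ?_
    filter_upwards [eventually_ge_atTop 1] with k hk
    rw [Real.norm_natCast]
    exact natCast_le_rpow_half_of_sq_le (tandemLength_sq_lt hk).le

theorem floor_mul_rpow_le_tandemLength {c : ℝ} {N : ℕ} (hσ : 0 ≤ σ) (hc : 0 ≤ c)
    (hm : ∀ i ≥ N, c * (i : ℝ) ^ σ ≤ m i) (hk : 1 ≤ k) (hkN : 2 * N ≤ k) :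
    ⌊min (c * (1 / 2) ^ σ) (1 / 2) * (k : ℝ) ^ min σ (1 / 2)⌋₊ ≤ tandemLength m k := by
  set n := ⌊min (c * (1 / 2) ^ σ) (1 / 2) * (k : ℝ) ^ min σ (1 / 2)⌋₊
  have hk1 : (1 : ℝ) ≤ k := Nat.one_le_cast.2 hk
  have hn_le : (n : ℝ) ≤ min (c * (1 / 2) ^ σ) (1 / 2) * (k : ℝ) ^ min σ (1 / 2) :=
    Nat.floor_le (by positivity)
  have hn_sqrt : (n : ℝ) ≤ 1 / 2 * √k :=
    hn_le.trans <| by rw [Real.sqrt_eq_rpow]; gcongr <;> exact min_le_right _ _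
  have hn_sq : 4 * n ^ 2 ≤ k := by
    have : 4 * (n : ℝ) ^ 2 ≤ k := by nlinarith [Real.sq_sqrt (Nat.cast_nonneg (α := ℝ) k)]
    exact_mod_cast this
  refine le_tandemLength (by omega) fun i hi _ => ?_
  have hki : 1 / 2 * (k : ℝ) ≤ i := by
    have : (k : ℝ) ≤ 2 * i := by exact_mod_cast (by omega : k ≤ 2 * i)
    linarith
  rify
  calc (n : ℝ) ≤ c * (1 / 2) ^ σ * (k : ℝ) ^ σ :=
        hn_le.trans (by gcongr <;> exact min_le_left _ _)
    _ = c * (1 / 2 * (k : ℝ)) ^ σ := by rw [Real.mul_rpow (by norm_num) (by positivity), mul_assoc]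
    _ ≤ c * (i : ℝ) ^ σ := by gcongr
    _ ≤ m i := hm i (by omega)

theorem tandemLength_add_one_isTheta
    (hm : (fun k => (m k : ℝ)) =Θ[atTop] fun k : ℕ => (k : ℝ) ^ σ) :
    (fun k => (tandemLength m k : ℝ) + 1) =Θ[atTop] fun k : ℕ => (k : ℝ) ^ min σ (1 / 2) := by
  have hσ : 0 ≤ σ := nonneg_of_natCast_isTheta_rpow hm
  constructor
  · refine (isBigO_tandemLength hm.1).add (.of_norm_eventuallyLE ?_)
    filter_upwards [eventually_ge_atTop 1] with k hk
    rw [norm_one]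
    exact Real.one_le_rpow (Nat.one_le_cast.2 hk) (by positivity)
  · obtain ⟨C, hC, hCm⟩ := hm.2.exists_pos
    obtain ⟨N, hN⟩ := eventually_atTop.1 hCm.bound
    have hlower : ∀ i ≥ N, C⁻¹ * (i : ℝ) ^ σ ≤ m i := fun i hi => by
      simpa [inv_mul_le_iff₀ hC, abs_of_nonneg (Real.rpow_nonneg (Nat.cast_nonneg i) σ)]
        using hN i hi
    refine .of_bound (min (C⁻¹ * (1 / 2) ^ σ) (1 / 2))⁻¹ ?_
    filter_upwards [eventually_ge_atTop 1, eventually_ge_atTop (2 * N)] with k hk hkN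
    rw [Real.norm_of_nonneg (by positivity), Real.norm_of_nonneg (by positivity),
      le_inv_mul_iff₀ (by positivity)]
    have hfloor := floor_mul_rpow_le_tandemLength hσ (inv_nonneg.2 hC.le) hlower hk hkN
    exact (Nat.lt_floor_add_one _).le.trans (by gcongr)

end TandemLength

end ErasureNetwork

theorem corollary3_general
    {S : Type*} [MeasurableSpace S] {Ω : Type*} [MeasurableSpace Ω]
    (prior : Bool → ℝ) (hprior : ∀ j, 0 < prior j) (hprior_sum : prior false + prior true = 1)
    (PX : Bool → Measure S) [∀ j, IsProbabilityMeasure (PX j)]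
    (hPX₁₀ : PX true ≪ PX false) (hPX₀₁ : PX false ≪ PX true)
    (htails : ErasureNetwork.HasLinearTails prior PX)
    (P : Bool → Measure Ω) [∀ j, IsProbabilityMeasure (P j)]
    (q : ℕ → ℝ) (X : ℕ → Ω → S) (Z : ℕ → Ω → Bool)
    (hmodel : ErasureNetwork.IsModel P PX q X Z)
    (ε : ℝ) (hε : 0 < ε) (hq : ∀ k, 1 ≤ k → q k ≤ 1 - ε) (m : ℕ → ℕ) (σ : ℝ)
    (hmσ : (fun k : ℕ => (m k : ℝ)) =Θ[atTop] fun k : ℕ => (k : ℝ) ^ σ)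
    (d : ℕ → Ω → Bool)
    (hd : ∀ k, 1 ≤ k → ∀ ω,
      ErasureNetwork.HasTandem (fun i => Z i ω) (ErasureNetwork.tandemLength m k) k →
      d k ω = ErasureNetwork.tandemDecision prior PX (fun i => X i ω) (fun i => Z i ω)
        (ErasureNetwork.tandemLength m k) (ErasureNetwork.tandemLength m k) k) :
    (fun k : ℕ => ErasureNetwork.errorProb prior P (d k)) =Θ[atTop]
      fun k : ℕ => 1 / (k : ℝ) ^ min σ (1 / 2) := by
  have hpos : ∀ᶠ k : ℕ in atTop, 1 ≤ k := eventually_ge_atTop 1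
  simp only [one_div (_ ^ _)]
  exact (hmodel.errorProb_isTheta hprior hprior_sum hPX₁₀ hPX₀₁ htails hε hq
    (hpos.mono fun _ => ErasureNetwork.tandemLength_sq_lt) (hpos.mono hd)).trans
    (ErasureNetwork.tandemLength_add_one_isTheta hmσ).inv

theorem corollary3
    {S : Type*} [MeasurableSpace S] {Ω : Type*} [MeasurableSpace Ω]
    (prior : Bool → ℝ) (hprior : ∀ j, 0 < prior j) (hprior_sum : prior false + prior true = 1)
    (PX : Bool → Measure S) [∀ j, IsProbabilityMeasure (PX j)]
    (hPX₁₀ : PX true ≪ PX false) (hPX₀₁ : PX false ≪ PX true)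
    (htails : ErasureNetwork.HasLinearTails prior PX)
    (P : Bool → Measure Ω) [∀ j, IsProbabilityMeasure (P j)]
    (q : ℕ → ℝ) (X : ℕ → Ω → S) (Z : ℕ → Ω → Bool)
    (hmodel : ErasureNetwork.IsModel P PX q X Z)
    (ε : ℝ) (hε : 0 < ε) (hq : ∀ k, 1 ≤ k → q k ≤ 1 - ε)
    (m : ℕ → ℕ) (hm : ∀ k, 1 ≤ k → m k < k)
    (σ : ℝ) (hσ : σ ≤ 1)
    (hmσ : (fun k : ℕ => (m k : ℝ)) =Θ[atTop] fun k : ℕ => (k : ℝ) ^ σ)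
    (d : ℕ → Ω → Bool) (hd_meas : ∀ k, Measurable (d k))
    (hd : ∀ k, 1 ≤ k → ∀ ω,
      ErasureNetwork.HasTandem (fun i => Z i ω) (ErasureNetwork.tandemLength m k) k →
      d k ω = ErasureNetwork.tandemDecision prior PX (fun i => X i ω) (fun i => Z i ω)
        (ErasureNetwork.tandemLength m k) (ErasureNetwork.tandemLength m k) k) :
    (1 / 2 ≤ σ →
      (fun k : ℕ => ErasureNetwork.errorProb prior P (d k)) =Θ[atTop]
        fun k : ℕ => 1 / Real.sqrt (k : ℝ)) ∧
    (σ < 1 / 2 →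
      (fun k : ℕ => ErasureNetwork.errorProb prior P (d k)) =Θ[atTop]
        fun k : ℕ => 1 / (k : ℝ) ^ σ) :=
  have herror := corollary3_general prior hprior hprior_sum PX hPX₁₀ hPX₀₁ htails P q X Z hmodel
    ε hε hq m σ hmσ d hd
  ⟨fun h => by simpa only [min_eq_right h, Real.sqrt_eq_rpow] using herror,
    fun h => by simpa only [min_eq_left h.le] using herror⟩
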